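/- Let $X$ be a CAT(0) space (not assumed proper or complete). For a geodesic $b:I\to X$ (an isometric embedding of a closed, possibly unbounded interval $I\subseteq\mathbb{R}$) with closest point projection $\pi_b$, and a number $r$ such that $[r-\tfrac12,r+\tfrac12]$ lies in the interior of $I$, the set $h=\pi_b^{-1}\big(b[r-\tfrac12,r+\tfrac12]\big)$ is called a \emph{curtain}, with half spaces $h^-=\pi_b^{-1}\big(b(I\cap(-\infty,r-\tfrac12))\big)$ and $h^+=\pi_b^{-1}\big(b(I\cap(r+\tfrac12,\infty))\big)$. A curtain \emph{separates} two sets if one of them lies in one of its half spaces and the other one lies in the other. Two curtains \emph{cross} if they have nonempty intersection. A \emph{chain} is a finite sequence $h_1,\dots,h_n$ of pairwise disjoint curtains such that $h_i$ separates $h_{i-1}$ from $h_{i+1}$ for all $1<i<n$. A \emph{curtain grid} is a pair of chains $\mathcal{H}=\{h_1,\dots,h_n\}$, $\mathcal{K}=\{k_1,\dots,k_m\}$ such that every curtain of $\mathcal{H}$ crosses every curtain of $\mathcal{K}$; for $E>0$ it is \emph{$E$-thin} if $\min\{|\mathcal{H}|,|\mathcal{K}|\}\le E$. Theorem E. $X$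 is Gromov hyperbolic (that is, for some $\delta\ge 0$ every side of every geodesic triangle in $X$ lies in the closed $\delta$-neighbourhood of the union of the other two sides) if and only if there is $E>0$ such that every curtain grid in $X$ is $E$-thin. -/

import Mathlib

namespace CurtainGrid

/-- `b` restricted to `I` is a (unit speed) geodesic: an isometric embedding of `I`. -/
def IsGeodesicOn {X : Type*} [MetricSpace X] (b : ℝ → X) (I : Set ℝ) : Prop :=
  ∀ s ∈ I, ∀ t ∈ I, dist (b s) (b t) = |s - t|

/-- `S` is (the image of) a geodesic segment `[x, y]` from `x` to `y`. -/
def IsGeodesicSegment {X : Type*} [MetricSpace X] (S : Set X) (x y : X) : Prop :=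
  ∃ γ : ℝ → X, IsGeodesicOn γ (Set.Icc 0 (dist x y)) ∧ γ 0 = x ∧ γ (dist x y) = y ∧
    S = γ '' Set.Icc 0 (dist x y)

/-- CAT(0) space: a geodesic metric space in which distances between points `p`, `q` of two sides
of a geodesic triangle are at most the distances between the corresponding points of the
comparison triangle in the Euclidean plane.  (For two points of the same side equality is
automatic; the triangle may be relabelled, so it is enough to name the common vertex `x`.) -/
structure IsCAT0 (X : Type*) [MetricSpace X] : Prop where
  exists_segment : ∀ x y : X, ∃ S : Set X, IsGeodesicSegment S x y
  comparison : ∀ (x y z : X) (Sxy Sxz Syz : Set X),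
    IsGeodesicSegment Sxy x y → IsGeodesicSegment Sxz x z → IsGeodesicSegment Syz y z →
    ∀ x' y' z' : EuclideanSpace ℝ (Fin 2),
      dist x' y' = dist x y → dist x' z' = dist x z → dist y' z' = dist y z →
    ∀ p ∈ Sxy, ∀ q ∈ Sxz, ∀ p' q' : EuclideanSpace ℝ (Fin 2),
      dist x' p' = dist x p → dist p' y' = dist p y →
      dist x' q' = dist x q → dist q' z' = dist q z →
      dist p q ≤ dist p' q'

/-- Gromov hyperbolicity of a geodesic space: all geodesic triangles are `δ`-slim,
for one constant `δ`. -/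
def IsGromovHyperbolic (X : Type*) [MetricSpace X] : Prop :=
  ∃ δ : ℝ, 0 ≤ δ ∧ ∀ (x y z : X) (Sxy Syz Sxz : Set X),
    IsGeodesicSegment Sxy x y → IsGeodesicSegment Syz y z → IsGeodesicSegment Sxz x z →
    ∀ p ∈ Sxy, ∃ q ∈ Syz ∪ Sxz, dist p q ≤ δ

/-- `b t` is a closest point to `x` on the geodesic `b : I → X`.  In a CAT(0) space, for `I` a
nonempty closed interval, there is exactly one such `t`, and `b t` is the closest point
projection of `x` to `b`. -/
def ProjectsTo {X : Type*} [MetricSpace X] (b : ℝ → X) (I : Set ℝ) (x : X) (t : ℝ) : Prop :=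
  t ∈ I ∧ ∀ s ∈ I, dist x (b t) ≤ dist x (b s)

/-- The data of a curtain: a geodesic `b : I → X` on a closed (possibly unbounded) interval `I`
and a number `r` with `[r - 1/2, r + 1/2]` contained in the interior of `I`. -/
structure Curtain (X : Type*) [MetricSpace X] where
  b : ℝ → X
  I : Set ℝ
  r : ℝ
  isClosed_I : IsClosed I
  ordConnected_I : I.OrdConnected
  isGeodesicOn : IsGeodesicOn b I
  pole_subset : Set.Icc (r - 1 / 2) (r + 1 / 2) ⊆ interior I

namespace Curtain

variable {X : Type*} [MetricSpace X]

/-- The curtain as a subset of `X`: the points whose projection to `b` lies in the pole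
`b [r - 1/2, r + 1/2]`. -/
def carrier (h : Curtain X) : Set X :=
  {x | ∃ t ∈ Set.Icc (h.r - 1 / 2) (h.r + 1 / 2), ProjectsTo h.b h.I x t}

/-- The half space `h⁻`: the points that project to `b` before the pole. -/
def neg (h : Curtain X) : Set X :=
  {x | ∃ t, t < h.r - 1 / 2 ∧ ProjectsTo h.b h.I x t}

/-- The half space `h⁺`: the points that project to `b` after the pole. -/
def pos (h : Curtain X) : Set X :=
  {x | ∃ t, h.r + 1 / 2 < t ∧ ProjectsTo h.b h.I x t}

/-- `h` separates `A` and `B`: they lie in different half spaces of `h`.  (Which half space is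
called `h⁻` only depends on the direction in which `b` is traversed.) -/
def Separates (h : Curtain X) (A B : Set X) : Prop :=
  (A ⊆ h.neg ∧ B ⊆ h.pos) ∨ (A ⊆ h.pos ∧ B ⊆ h.neg)

/-- Two curtains cross if they meet. -/
def Crosses (h k : Curtain X) : Prop :=
  (h.carrier ∩ k.carrier).Nonempty

end Curtain

/-- The curtains `h 0, …, h (n - 1)` form a chain: they are pairwise disjoint, and each one
separates its predecessor from its successor.  Being disjoint and nonempty they are distinct,
so that the chain has cardinality `n`. -/
def IsChain {X : Type*} [MetricSpace X] {n : ℕ} (h : Fin n → Curtain X) : Prop :=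
  (∀ i j, i ≠ j → Disjoint (h i).carrier (h j).carrier) ∧
  ∀ i j k : Fin n, (i : ℕ) + 1 = j → (j : ℕ) + 1 = k →
    (h j).Separates (h i).carrier (h k).carrier

/-- Two chains form a curtain grid if every curtain of one crosses every curtain of the other. -/
def IsCurtainGrid {X : Type*} [MetricSpace X] {n m : ℕ}
    (H : Fin n → Curtain X) (K : Fin m → Curtain X) : Prop :=
  IsChain H ∧ IsChain K ∧ ∀ i j, (H i).Crosses (K j)

/-- Every curtain grid of `X` is `E`-thin: the shorter of its two chains has at most `E`
curtains. -/
def AllGridsThin (X : Type*) [MetricSpace X] (E : ℝ) : Prop :=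
  ∀ (n m : ℕ) (H : Fin n → Curtain X) (K : Fin m → Curtain X),
    IsCurtainGrid H K → min (n : ℝ) (m : ℝ) ≤ E

end CurtainGrid

namespace CurtainGrid

variable {X : Type*} [MetricSpace X]

open Set

/-! Thin grids give slim triangles. Let `p` lie on a geodesic from `x` to `y` and project to `b s`,
with `x` and `y` projecting far from `b s` on either side or both on one side. If `p` is far from
`b`, let `c` be the perpendicular from `b s` to `p`. One of `x`, `y` projects to the end `p` of `c`
(`projectsTo_end_or`), and then the curtains dual to `b` and to `c` form a large grid
(`exists_grid`). So without large grids `p` is near `b`, and a side of a triangle can be followed by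
one of the other two.

Conversely, the end curtains of a long chain are far apart (`isChain_sub_two_le_dist`), and in a
hyperbolic space curtains are quasiconvex (`exists_mem_carrier_dist_le`). Take the four corners of a
grid. By slimness, each point of a diagonal is near one of two adjacent outer curtains, and near one
of the two opposite to them. If both chains are long, the diagonal passes from one end curtain of
`H` to the other while always near one of them, so by connectedness some point is near both, which
is absurd. -/

/-! ### Geodesics and segments -/

lemma IsGeodesicOn.mono {b : ℝ → X} {I J : Set ℝ} (hb : IsGeodesicOn b I) (h : J ⊆ I) :
    IsGeodesicOn b J := fun s hs t ht => hb s (h hs) t (h ht)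

lemma IsGeodesicOn.continuousOn {b : ℝ → X} {I : Set ℝ} (hb : IsGeodesicOn b I) :
    ContinuousOn b I := by
  have : LipschitzOnWith 1 b I := LipschitzOnWith.of_dist_le_mul fun s hs t ht => by
    rw [hb s hs t ht, Real.dist_eq]; simp
  exact this.continuousOn

lemma IsGeodesicOn.dist_of_le {b : ℝ → X} {I : Set ℝ} (hb : IsGeodesicOn b I) {s t : ℝ}
    (hs : s ∈ I) (ht : t ∈ I) (h : s ≤ t) : dist (b s) (b t) = t - s := by
  rw [hb s hs t ht, abs_sub_comm, abs_of_nonneg (by linarith)]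

lemma isGeodesicSegment_image {b : ℝ → X} {u v : ℝ} (huv : u ≤ v)
    (hb : IsGeodesicOn b (Icc u v)) : IsGeodesicSegment (b '' Icc u v) (b u) (b v) := by
  have hd : dist (b u) (b v) = v - u := hb.dist_of_le (by simp [huv]) (by simp [huv]) huv
  refine ⟨fun t => b (u + t), ?_, by simp, by simp [hd], ?_⟩
  · rw [hd]
    intro s hs t ht
    rw [hb (u + s) ⟨by linarith [hs.1], by linarith [hs.2]⟩ (u + t)
      ⟨by linarith [ht.1], by linarith [ht.2]⟩]
    congr 1; ring
  · rw [hd]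
    ext x
    constructor
    · rintro ⟨t, ht, rfl⟩
      exact ⟨t - u, ⟨by linarith [ht.1], by linarith [ht.2]⟩, by simp⟩
    · rintro ⟨t, ht, rfl⟩
      exact ⟨u + t, ⟨by linarith [ht.1], by linarith [ht.2]⟩, rfl⟩

lemma IsGeodesicSegment.left_mem {S : Set X} {x y : X} (h : IsGeodesicSegment S x y) : x ∈ S := by
  obtain ⟨γ, -, h0, -, rfl⟩ := h
  exact ⟨0, by simp, h0⟩

lemma IsGeodesicSegment.right_mem {S : Set X} {x y : X} (h : IsGeodesicSegment S x y) :
    y ∈ S := by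
  obtain ⟨γ, -, -, h1, rfl⟩ := h
  exact ⟨dist x y, by simp, h1⟩

lemma IsGeodesicSegment.dist_add_dist {S : Set X} {x y w : X} (h : IsGeodesicSegment S x y)
    (hw : w ∈ S) : dist x w + dist w y = dist x y := by
  obtain ⟨γ, hγ, h0, h1, rfl⟩ := h
  obtain ⟨t, ht, rfl⟩ := hw
  have e1 := hγ.dist_of_le (s := 0) (by simp) ht ht.1
  have e2 := hγ.dist_of_le (t := dist x y) ht (by simp) ht.2
  rw [h0] at e1
  rw [h1] at e2
  rw [e1, e2]; ring

lemma IsGeodesicSegment.isPreconnected {S : Set X} {x y : X} (h : IsGeodesicSegment S x y) :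
    IsPreconnected S := by
  obtain ⟨γ, hγ, -, -, rfl⟩ := h
  exact isPreconnected_Icc.image _ hγ.continuousOn

lemma IsGeodesicSegment.symm {S : Set X} {x y : X} (h : IsGeodesicSegment S x y) :
    IsGeodesicSegment S y x := by
  obtain ⟨γ, hγ, h0, h1, rfl⟩ := h
  refine ⟨fun t => γ (dist x y - t), ?_, by simpa using h1, by simpa [dist_comm y x] using h0, ?_⟩
  · rw [dist_comm y x]
    intro s hs t ht
    rw [hγ (dist x y - s) ⟨by linarith [hs.2], by linarith [hs.1]⟩ (dist x y - t)
      ⟨by linarith [ht.2], by linarith [ht.1]⟩, abs_sub_comm]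
    congr 1; ring
  · rw [dist_comm y x]
    ext p
    constructor
    · rintro ⟨t, ht, rfl⟩
      exact ⟨dist x y - t, ⟨by linarith [ht.2], by linarith [ht.1]⟩, by simp⟩
    · rintro ⟨t, ht, rfl⟩
      exact ⟨dist x y - t, ⟨by linarith [ht.2], by linarith [ht.1]⟩, rfl⟩

lemma IsGeodesicSegment.exists_apply_eq {S : Set X} {x y : X} (h : IsGeodesicSegment S x y)
    {f : X → ℝ} (hf : Continuous f) {r : ℝ} (hr : r ∈ uIcc (f x) (f y)) : ∃ w ∈ S, f w = r := by
  have : (f '' S).OrdConnected :=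
    (h.isPreconnected.image f hf.continuousOn).ordConnected
  exact this.uIcc_subset ⟨x, h.left_mem, rfl⟩ ⟨y, h.right_mem, rfl⟩ hr

/-! ### CAT(0) inequalities and closest point projections -/

/-- Comparison of a point on a geodesic with the opposite vertex. -/
lemma IsCAT0.stewart (hX : IsCAT0 X) {b : ℝ → X} {u v s : ℝ} (hb : IsGeodesicOn b (Icc u v))
    (hs : s ∈ Icc u v) (z : X) :
    (v - u) * dist (b s) z ^ 2 ≤ (v - s) * dist (b u) z ^ 2 + (s - u) * dist (b v) z ^ 2
      - (s - u) * (v - s) * (v - u) := by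
  rcases eq_or_lt_of_le (hs.1.trans hs.2) with huv | huv
  · obtain rfl : s = u := le_antisymm (by linarith [hs.2]) hs.1
    subst huv
    simp
  have hu : u ∈ Icc u v := ⟨le_rfl, huv.le⟩
  have hv : v ∈ Icc u v := ⟨huv.le, le_rfl⟩
  obtain ⟨Sxz, hSxz⟩ := hX.exists_segment (b u) z
  obtain ⟨Syz, hSyz⟩ := hX.exists_segment (b v) z
  have dxy := hb.dist_of_le hu hv huv.le
  have dxp := hb.dist_of_le hu hs hs.1
  have dpy := hb.dist_of_le hs hv hs.2
  set l := v - u with hl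
  set A := dist (b u) z with hA
  set B := dist (b v) z with hB
  have hl0 : 0 < l := by linarith
  have t1 : A ≤ l + B := by rw [← dxy]; exact dist_triangle _ _ _
  have t2 : B ≤ l + A := by rw [← dxy, dist_comm (b u) (b v)]; exact dist_triangle _ _ _
  have t3 : l ≤ A + B := by
    rw [← dxy, hB, dist_comm (b v) z]; exact dist_triangle _ _ _
  have A0 : 0 ≤ A := dist_nonneg
  have B0 : 0 ≤ B := dist_nonneg
  -- By the law of cosines, the comparison triangle has vertices `(0, 0)`, `(l, 0)`, `(m, q)`; the
  -- triangle inequalities make `q` real.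
  set m := (A ^ 2 + l ^ 2 - B ^ 2) / (2 * l) with hm
  have hml : m * (2 * l) = A ^ 2 + l ^ 2 - B ^ 2 := by rw [hm]; field_simp
  have hmA : m ^ 2 ≤ A ^ 2 := by
    apply sq_le_sq'
    · rw [hm, le_div_iff₀ (by positivity)]
      nlinarith [mul_nonneg (sub_nonneg.2 t2) (add_nonneg (add_nonneg A0 hl0.le) B0)]
    · rw [hm, div_le_iff₀ (by positivity)]
      nlinarith [mul_nonneg (sub_nonneg.2 t1) (sub_nonneg.2 t3)]
  have hq : Real.sqrt (A ^ 2 - m ^ 2) ^ 2 = A ^ 2 - m ^ 2 := Real.sq_sqrt (by linarith)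
  set q := Real.sqrt (A ^ 2 - m ^ 2)
  have key := hX.comparison (b u) (b v) z _ Sxz Syz (isGeodesicSegment_image huv.le hb) hSxz hSyz
    !₂[0, 0] !₂[l, 0] !₂[m, q]
    (by rw [dxy]; simp [EuclideanSpace.dist_eq, Real.sqrt_sq_eq_abs, abs_of_pos hl0])
    (by
      rw [EuclideanSpace.dist_eq, Real.sqrt_eq_iff_mul_self_eq (by positivity) A0]
      simp [Real.dist_eq]; linarith)
    (by
      rw [EuclideanSpace.dist_eq, Real.sqrt_eq_iff_mul_self_eq (by positivity) B0]
      simp [Real.dist_eq]; nlinarith)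
    (b s) ⟨s, hs, rfl⟩ z hSxz.right_mem !₂[s - u, 0] !₂[m, q]
    (by
      rw [dxp, EuclideanSpace.dist_eq,
        Real.sqrt_eq_iff_mul_self_eq (by positivity) (sub_nonneg.2 hs.1)]
      simp [Real.dist_eq]; ring)
    (by
      rw [dpy, EuclideanSpace.dist_eq,
        Real.sqrt_eq_iff_mul_self_eq (by positivity) (sub_nonneg.2 hs.2)]
      simp [Real.dist_eq]; rw [hl]; ring)
    (by
      rw [EuclideanSpace.dist_eq, Real.sqrt_eq_iff_mul_self_eq (by positivity) A0]
      simp [Real.dist_eq]; linarith)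
    (by simp)
  have key2 : dist (b s) z ^ 2 ≤ (s - u - m) ^ 2 + q ^ 2 := by
    rw [EuclideanSpace.dist_eq] at key
    have := pow_le_pow_left₀ dist_nonneg key 2
    rw [Real.sq_sqrt (by positivity)] at this
    simpa [Real.dist_eq] using this
  rw [hq] at key2
  have : v - s = l - (s - u) := by rw [hl]; ring
  rw [this]
  have hml' : (s - u) * (m * (2 * l)) = (s - u) * (A ^ 2 + l ^ 2 - B ^ 2) := by rw [hml]
  linarith [mul_le_mul_of_nonneg_left key2 hl0.le]

/-- The angle at the foot is at least a right angle: if the inequality failed, a small step from `t`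
towards `s` would, by `stewart`, come closer to `x` than the foot. -/
lemma IsCAT0.sq_dist_add_sq_le (hX : IsCAT0 X) {b : ℝ → X} {I : Set ℝ} (hI : I.OrdConnected)
    (hb : IsGeodesicOn b I) {x : X} {t s : ℝ} (ht : ProjectsTo b I x t) (hs : s ∈ I) :
    dist x (b t) ^ 2 + (s - t) ^ 2 ≤ dist x (b s) ^ 2 := by
  have hcmp : ∀ r ∈ I, dist (b t) x ^ 2 ≤ dist (b r) x ^ 2 := fun r hr => by
    rw [dist_comm _ x, dist_comm _ x]
    exact pow_le_pow_left₀ dist_nonneg (ht.2 r hr) 2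
  rw [dist_comm x, dist_comm x]
  rcases lt_trichotomy t s with h | rfl | h
  · by_contra! hc
    obtain ⟨e, he0, he⟩ : ∃ e > 0, e < s - t ∧
        dist (b s) x ^ 2 < dist (b t) x ^ 2 + (s - t) * (s - t - e) := by
      set a := dist (b t) x ^ 2 + (s - t) ^ 2 - dist (b s) x ^ 2 with ha
      have ha0 : 0 < a := by linarith
      have hT : 0 < s - t := by linarith
      refine ⟨min ((s - t) / 2) (a / (2 * (s - t))), by positivity, ?_, ?_⟩
      · exact (min_le_left _ _).trans_lt (by linarith)
      · have : (s - t) * min ((s - t) / 2) (a / (2 * (s - t))) ≤ a / 2 :=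
          (mul_le_mul_of_nonneg_left (min_le_right _ _) hT.le).trans_eq (by field_simp)
        nlinarith
    have h1 := hX.stewart (hb.mono (hI.out ht.1 hs)) (s := t + e)
      ⟨by linarith, by linarith⟩ x
    have h2 := hcmp (t + e) (hI.out ht.1 hs ⟨by linarith, by linarith⟩)
    have h3 := mul_le_mul_of_nonneg_left h2 (sub_pos.2 h).le
    have h4 := mul_lt_mul_of_pos_left he.2 he0
    nlinarith
  · simp
  · by_contra! hc
    obtain ⟨e, he0, he⟩ : ∃ e > 0, e < t - s ∧
        dist (b s) x ^ 2 < dist (b t) x ^ 2 + (t - s) * (t - s - e) := by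
      set a := dist (b t) x ^ 2 + (s - t) ^ 2 - dist (b s) x ^ 2 with ha
      have ha0 : 0 < a := by linarith
      have hT : 0 < t - s := by linarith
      refine ⟨min ((t - s) / 2) (a / (2 * (t - s))), by positivity, ?_, ?_⟩
      · exact (min_le_left _ _).trans_lt (by linarith)
      · have : (t - s) * min ((t - s) / 2) (a / (2 * (t - s))) ≤ a / 2 :=
          (mul_le_mul_of_nonneg_left (min_le_right _ _) hT.le).trans_eq (by field_simp)
        nlinarith
    have h1 := hX.stewart (hb.mono (hI.out hs ht.1)) (s := t - e)
      ⟨by linarith, by linarith⟩ x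
    have h2 := hcmp (t - e) (hI.out hs ht.1 ⟨by linarith, by linarith⟩)
    have h3 := mul_le_mul_of_nonneg_left h2 (sub_pos.2 h).le
    have h4 := mul_lt_mul_of_pos_left he.2 he0
    nlinarith

/-- Apply `stewart` at the midpoint of one diagonal, and bound the other diagonal by the path
through it. -/
lemma IsCAT0.quadrilateral (hX : IsCAT0 X) (x y a b : X) :
    dist a y ^ 2 + dist x b ^ 2 ≤
      dist x y ^ 2 + dist y b ^ 2 + dist a x ^ 2 + dist a b ^ 2 := by
  obtain ⟨S, γ, hγ, h0, h1, -⟩ := hX.exists_segment x b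
  have hl : 0 ≤ dist x b := dist_nonneg
  have hm : dist x b / 2 ∈ Icc 0 (dist x b) := ⟨by linarith, by linarith⟩
  rcases hl.eq_or_lt with hl | hl
  · obtain rfl : x = b := dist_eq_zero.1 hl.symm
    have := dist_triangle a x y
    have h2 := pow_le_pow_left₀ dist_nonneg this 2
    rw [dist_self, dist_comm y x]
    nlinarith [sq_nonneg (dist a x - dist x y)]
  have ey := hX.stewart hγ hm y
  have ea := hX.stewart hγ hm a
  rw [h0, h1] at ey ea
  set m := γ (dist x b / 2)
  have ey' : dist m y ^ 2 ≤ dist x y ^ 2 / 2 + dist b y ^ 2 / 2 - dist x b ^ 2 / 4 :=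
    le_of_mul_le_mul_left (by nlinarith) hl
  have ea' : dist m a ^ 2 ≤ dist x a ^ 2 / 2 + dist b a ^ 2 / 2 - dist x b ^ 2 / 4 :=
    le_of_mul_le_mul_left (by nlinarith) hl
  have h2 := pow_le_pow_left₀ dist_nonneg (dist_triangle a m y) 2
  rw [dist_comm a m] at h2
  rw [dist_comm y b, dist_comm a x, dist_comm a b]
  nlinarith [sq_nonneg (dist m a - dist m y)]

/-- Two right angles at the feet, added to the quadrilateral inequality, leave `(s - t) ^ 2 ≤ dist x
y ^ 2`. With `x = y` this gives uniqueness of the foot. -/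
lemma IsCAT0.abs_sub_le_dist (hX : IsCAT0 X) {b : ℝ → X} {I : Set ℝ} (hI : I.OrdConnected)
    (hb : IsGeodesicOn b I) {x y : X} {s t : ℝ} (hs : ProjectsTo b I x s)
    (ht : ProjectsTo b I y t) : |s - t| ≤ dist x y := by
  have h1 := hX.sq_dist_add_sq_le hI hb hs ht.1
  have h2 := hX.sq_dist_add_sq_le hI hb ht hs.1
  have h3 := hX.quadrilateral x y (b s) (b t)
  rw [hb s hs.1 t ht.1, sq_abs, dist_comm (b s) y, dist_comm (b s) x] at h3
  exact abs_le_of_sq_le_sq (by nlinarith) dist_nonneg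

/-- Compactness is needed only in the parameter line, so `X` need be neither proper nor complete. -/
lemma exists_projectsTo {b : ℝ → X} {I : Set ℝ} (hI : IsClosed I) (hne : I.Nonempty)
    (hb : IsGeodesicOn b I) (x : X) : ∃ t, ProjectsTo b I x t := by
  obtain ⟨t₀, ht₀⟩ := hne
  set R := 2 * dist x (b t₀)
  have hR : 0 ≤ R := by positivity
  obtain ⟨t, ht, hmin⟩ := ((isCompact_closedBall t₀ R).inter_left hI).exists_isMinOn
    ⟨t₀, ht₀, Metric.mem_closedBall_self hR⟩
    (f := fun t => dist x (b t))
    ((continuous_const.dist continuous_id).comp_continuousOn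
      (hb.mono inter_subset_left).continuousOn)
  refine ⟨t, ht.1, fun s hs => ?_⟩
  by_cases hsR : s ∈ Metric.closedBall t₀ R
  · exact hmin ⟨hs, hsR⟩
  · have h0 : dist x (b t) ≤ dist x (b t₀) := hmin ⟨ht₀, Metric.mem_closedBall_self hR⟩
    have h1 : R < |s - t₀| := by simpa [Real.dist_eq] using hsR
    rw [← hb s hs t₀ ht₀] at h1
    have h2 := dist_triangle_left (b s) (b t₀) x
    change dist x (b t) ≤ dist x (b s)
    simp only [R] at h1
    linarith

/-- The closest point projection to a geodesic, as a `1`-Lipschitz function to its domain. -/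
lemma IsCAT0.exists_projection (hX : IsCAT0 X) {b : ℝ → X} {I : Set ℝ} (hcl : IsClosed I)
    (hI : I.OrdConnected) (hne : I.Nonempty) (hb : IsGeodesicOn b I) :
    ∃ f : X → ℝ, (∀ x y, |f x - f y| ≤ dist x y) ∧ ∀ x t, ProjectsTo b I x t ↔ f x = t := by
  choose f hf using exists_projectsTo hcl hne hb
  refine ⟨f, fun x y => hX.abs_sub_le_dist hI hb (hf x) (hf y), fun x t => ⟨fun h => ?_, ?_⟩⟩
  · have := hX.abs_sub_le_dist hI hb (hf x) h
    rw [dist_self] at this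
    exact sub_eq_zero.1 (abs_nonpos_iff.1 this)
  · rintro rfl
    exact hf x

lemma continuous_of_abs_sub_le_dist {f : X → ℝ} (hf : ∀ x y, |f x - f y| ≤ dist x y) :
    Continuous f := by
  have : LipschitzWith 1 f := LipschitzWith.of_dist_le_mul fun x y => by
    simpa [Real.dist_eq] using hf x y
  exact this.continuous

/-- Projections are constant on the geodesic from a point to its projection. -/
lemma ProjectsTo.of_dist_add {b : ℝ → X} {I : Set ℝ} {x y : X} {t : ℝ} (h : ProjectsTo b I x t)
    (hy : dist x y + dist y (b t) = dist x (b t)) : ProjectsTo b I y t := by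
  refine ⟨h.1, fun s hs => ?_⟩
  linarith [h.2 s hs, dist_triangle x y (b s)]

lemma projectsTo_self {b : ℝ → X} {I : Set ℝ} {t : ℝ} (ht : t ∈ I) :
    ProjectsTo b I (b t) t := ⟨ht, fun s _ => by simp⟩

/-- The points of a geodesic `b` project to the foot of a perpendicular `c` to `b`. -/
lemma IsCAT0.projectsTo_perpendicular (hX : IsCAT0 X) {b c : ℝ → X} {I : Set ℝ} {L s t : ℝ}
    (hI : I.OrdConnected) (hb : IsGeodesicOn b I) (hL : 0 ≤ L) (hc : IsGeodesicOn c (Icc 0 L))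
    (h0 : c 0 = b s) (hs : ProjectsTo b I (c L) s) (ht : t ∈ I) :
    ProjectsTo c (Icc 0 L) (b t) 0 := by
  refine ⟨⟨le_rfl, hL⟩, fun r hr => ?_⟩
  have h1 : ProjectsTo b I (c r) s := by
    apply hs.of_dist_add
    rw [← h0, hc L ⟨hL, le_rfl⟩ r hr, hc r hr 0 ⟨le_rfl, hL⟩, hc L ⟨hL, le_rfl⟩ 0 ⟨le_rfl, hL⟩,
      abs_of_nonneg (by linarith [hr.2]), abs_of_nonneg (by linarith [hr.1]),
      abs_of_nonneg (by linarith)]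
    ring
  have h2 := hX.sq_dist_add_sq_le hI hb h1 ht
  rw [h0, hb t ht s hs.1, dist_comm]
  exact abs_le_of_sq_le_sq (by nlinarith [sq_nonneg (dist (c r) (b s))]) dist_nonneg

/-- If `c` ends at an interior point of a geodesic, then one of the two ends of that geodesic
projects to the end of `c`. -/
lemma IsCAT0.projectsTo_end_or (hX : IsCAT0 X) {c : ℝ → X} {L : ℝ} (hL : 0 ≤ L)
    (hc : IsGeodesicOn c (Icc 0 L)) {x y : X} (hxy : dist x (c L) + dist (c L) y = dist x y) :
    ProjectsTo c (Icc 0 L) x L ∨ ProjectsTo c (Icc 0 L) y L := by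
  by_contra! hcon
  -- By convexity, one closer point on `c` makes all later points before the end closer too. A
  -- parameter common to both ends then gives a shortcut from `x` to `y`.
  have key : ∀ z, ¬ ProjectsTo c (Icc 0 L) z L → ∃ t ∈ Ico 0 L, ∀ r ∈ Ico t L,
      dist (c r) z < dist (c L) z := by
    intro z hz
    simp only [ProjectsTo, not_and, not_forall, not_le] at hz
    obtain ⟨t, ht, hlt⟩ := hz ⟨hL, le_rfl⟩
    have htL : t < L := lt_of_le_of_ne ht.2 (by rintro rfl; exact lt_irrefl _ hlt)
    refine ⟨t, ⟨ht.1, htL⟩, fun r hr => ?_⟩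
    have h1 := hX.stewart (hc.mono (Icc_subset_Icc_left ht.1)) (s := r) ⟨hr.1, hr.2.le⟩ z
    rw [dist_comm z, dist_comm z] at hlt
    have h2 := pow_lt_pow_left₀ hlt dist_nonneg (two_ne_zero)
    have h3 := mul_lt_mul_of_pos_left h2 (sub_pos.2 hr.2)
    have h4 : 0 ≤ (r - t) * (L - r) * (L - t) :=
      mul_nonneg (mul_nonneg (sub_nonneg.2 hr.1) (sub_pos.2 hr.2).le) (sub_pos.2 htL).le
    exact lt_of_pow_lt_pow_left₀ 2 dist_nonneg
      (lt_of_mul_lt_mul_left (by nlinarith) (sub_pos.2 htL).le)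
  obtain ⟨t, ht, h1⟩ := key x hcon.1
  obtain ⟨t', ht', h2⟩ := key y hcon.2
  have := h1 (max t t') ⟨le_max_left _ _, max_lt ht.2 ht'.2⟩
  have := h2 (max t t') ⟨le_max_right _ _, max_lt ht.2 ht'.2⟩
  have := dist_triangle_left x y (c (max t t'))
  rw [dist_comm x (c L)] at hxy
  linarith

/-! ### Dual chains and thin grids -/

/-- The curtain dual to `b : [u, v] → X` centred at `r`. -/
def dualCurtain {b : ℝ → X} {u v : ℝ} (hb : IsGeodesicOn b (Icc u v)) (r : ℝ)
    (h : u < r - 1 / 2 ∧ r + 1 / 2 < v) : Curtain X where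
  b := b
  I := Icc u v
  r := r
  isClosed_I := isClosed_Icc
  ordConnected_I := ordConnected_Icc
  isGeodesicOn := hb
  pole_subset := by rw [interior_Icc]; exact Icc_subset_Ioo h.1 h.2

lemma IsCAT0.isChain_dualCurtain (hX : IsCAT0 X) {b : ℝ → X} {u v r : ℝ} {n : ℕ}
    (hb : IsGeodesicOn b (Icc u v))
    (h : ∀ i : Fin n, u < r + 2 * (i : ℕ) - 1 / 2 ∧ r + 2 * (i : ℕ) + 1 / 2 < v) :
    IsChain fun i => dualCurtain hb (r + 2 * (i : ℕ)) (h i) := by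
  constructor
  · intro i j hij
    rw [Set.disjoint_left]
    rintro x ⟨s, hs, hxs⟩ ⟨t, ht, hxt⟩
    have hst := hX.abs_sub_le_dist ordConnected_Icc hb hxs hxt
    rw [dist_self] at hst
    obtain rfl : s = t := sub_eq_zero.1 (abs_nonpos_iff.1 hst)
    simp only [dualCurtain] at hs ht
    rcases lt_or_gt_of_ne (fun h => hij (Fin.ext h) : (i : ℕ) ≠ j) with hlt | hlt
    · have : ((i : ℕ) : ℝ) + 1 ≤ (j : ℕ) := by exact_mod_cast hlt
      linarith [hs.2, ht.1]
    · have : ((j : ℕ) : ℝ) + 1 ≤ (i : ℕ) := by exact_mod_cast hlt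
      linarith [hs.1, ht.2]
  · intro i j k hij hjk
    have hij' : ((i : ℕ) : ℝ) + 1 = (j : ℕ) := by exact_mod_cast hij
    have hjk' : ((j : ℕ) : ℝ) + 1 = (k : ℕ) := by exact_mod_cast hjk
    left
    constructor
    · rintro x ⟨t, ht, hxt⟩
      refine ⟨t, ?_, hxt⟩
      simp only [dualCurtain] at ht ⊢
      linarith [ht.2]
    · rintro x ⟨t, ht, hxt⟩
      refine ⟨t, ?_, hxt⟩
      simp only [dualCurtain] at ht ⊢
      linarith [ht.1]

/-- If `c` is a long perpendicular from `b` to `p`, and `x` projects far from `p` on `b` but to `p`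
on `c`, then there is a large grid of curtains dual to `b` and to `c`. -/
lemma IsCAT0.exists_grid (hX : IsCAT0 X) {b c : ℝ → X} {u v s t L : ℝ} {N : ℕ} {x : X}
    (hb : IsGeodesicOn b (Icc u v)) (hc : IsGeodesicOn c (Icc 0 L)) (hL : 2 * (N : ℝ) ≤ L)
    (h0 : c 0 = b s) (hs : ProjectsTo b (Icc u v) (c L) s) (ht : ProjectsTo b (Icc u v) x t)
    (hst : 2 * (N : ℝ) ≤ |s - t|) (hx : ProjectsTo c (Icc 0 L) x L) :
    ∃ H K : Fin N → Curtain X, IsCurtainGrid H K := by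
  have hL0 : 0 ≤ L := le_trans (by positivity) hL
  obtain ⟨f, hf, hfp⟩ := hX.exists_projection isClosed_Icc ordConnected_Icc ⟨s, hs.1⟩ hb
  obtain ⟨g, hg, hgp⟩ := hX.exists_projection isClosed_Icc ordConnected_Icc
    ⟨0, le_rfl, hL0⟩ hc
  have hfc := continuous_of_abs_sub_le_dist hf
  have hgc := continuous_of_abs_sub_le_dist hg
  have hi : ∀ i : Fin N, (0 : ℝ) ≤ (i : ℕ) ∧ ((i : ℕ) : ℝ) + 1 ≤ N := fun i =>
    ⟨by positivity, by exact_mod_cast i.2⟩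
  obtain ⟨r, hr⟩ : ∃ r, ∀ i : Fin N, min s t + 1 / 2 < r + 2 * (i : ℕ) ∧
      r + 2 * (i : ℕ) + 1 / 2 < max s t := by
    -- Centres at odd distances from the end: `N` unit poles at spacing 2 fit inside length `2 * N`.
    refine ⟨min s t + 1, fun i => ?_⟩
    have : max s t - min s t = |s - t| := max_sub_min_eq_abs' s t
    constructor <;> linarith [(hi i).1, (hi i).2]
  have hu : u ≤ min s t := le_min hs.1.1 ht.1.1
  have hv : max s t ≤ v := max_le hs.1.2 ht.1.2
  have hr' : ∀ i : Fin N, u < r + 2 * (i : ℕ) - 1 / 2 ∧ r + 2 * (i : ℕ) + 1 / 2 < v := fun i =>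
    ⟨by linarith [(hr i).1], by linarith [(hr i).2]⟩
  have hk : ∀ i : Fin N, 0 < 1 + 2 * ((i : ℕ) : ℝ) - 1 / 2 ∧ 1 + 2 * ((i : ℕ) : ℝ) + 1 / 2 < L :=
    fun i => ⟨by linarith [(hi i).1], by linarith [(hi i).2]⟩
  refine ⟨_, _, hX.isChain_dualCurtain hb hr', hX.isChain_dualCurtain hc hk, fun i j => ?_⟩
  set ρ := r + 2 * ((i : ℕ) : ℝ) with hρ
  set κ := 1 + 2 * ((j : ℕ) : ℝ) with hκ
  -- On `[x, c L]` the projection to `c` stays at `L` while that to `b` sweeps past `ρ`.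
  obtain ⟨S, hS⟩ := hX.exists_segment x (c L)
  obtain ⟨w, hwS, hw⟩ := hS.exists_apply_eq hfc (r := ρ) (by
    rw [(hfp _ _).1 ht, (hfp _ _).1 hs, uIcc_comm]
    exact ⟨show min s t ≤ ρ by linarith [(hr i).1], show ρ ≤ max s t by linarith [(hr i).2]⟩)
  have hwL : g w = L := (hgp _ _).1 (hx.of_dist_add (hS.dist_add_dist hwS))
  have hwρ := (hfp _ _).2 hw
  have hb0 : g (b ρ) = 0 := (hgp _ _).1
    (hX.projectsTo_perpendicular ordConnected_Icc hb hL0 hc h0 hs hwρ.1)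
  -- On `[w, b ρ]` the projection to `b` stays at `ρ` while that to `c` sweeps from `L` to `0`.
  obtain ⟨T, hT⟩ := hX.exists_segment w (b ρ)
  obtain ⟨y, hyT, hy⟩ := hT.exists_apply_eq hgc (r := κ) (by
    rw [hwL, hb0, uIcc_of_ge hL0]
    exact ⟨by linarith [(hk j).1], by linarith [(hk j).2]⟩)
  refine ⟨y, ⟨ρ, ?_, hwρ.of_dist_add (hT.dist_add_dist hyT)⟩, ⟨κ, ?_, (hgp _ _).2 hy⟩⟩
  · simp only [dualCurtain, mem_Icc]; constructor <;> linarith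
  · simp only [dualCurtain, mem_Icc]; constructor <;> linarith

/-- A geodesic that travels far along `b` on both sides of a point passes close to `b` there. -/
lemma IsCAT0.dist_lt_of_no_grid (hX : IsCAT0 X) {N : ℕ}
    (hN : ¬ ∃ H K : Fin N → Curtain X, IsCurtainGrid H K) {b : ℝ → X} {u v s t t' : ℝ}
    (hb : IsGeodesicOn b (Icc u v)) {x y p : X} (hp : dist x p + dist p y = dist x y)
    (hs : ProjectsTo b (Icc u v) p s) (ht : ProjectsTo b (Icc u v) x t)
    (ht' : ProjectsTo b (Icc u v) y t') (hst : 2 * (N : ℝ) ≤ |s - t|)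
    (hst' : 2 * (N : ℝ) ≤ |s - t'|) : dist p (b s) < 2 * N := by
  by_contra! hlt
  obtain ⟨S, c, hc, h0, h1, -⟩ := hX.exists_segment (b s) p
  rw [dist_comm] at hlt
  rw [← h1] at hp hs
  rcases hX.projectsTo_end_or dist_nonneg hc hp with h | h
  · exact hN (hX.exists_grid hb hc hlt h0 hs ht hst h)
  · exact hN (hX.exists_grid hb hc hlt h0 hs ht' hst' h)

theorem IsCAT0.isGromovHyperbolic_of_thin (hX : IsCAT0 X) {E : ℝ} (hE : AllGridsThin X E) :
    IsGromovHyperbolic X := by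
  obtain ⟨N, hNE⟩ := exists_nat_gt E
  have hN : ¬ ∃ H K : Fin N → Curtain X, IsCurtainGrid H K := by
    rintro ⟨H, K, h⟩
    have := hE N N H K h
    rw [min_self] at this
    linarith
  refine ⟨4 * N, by positivity, fun x y z Sxy Syz Sxz hxy hyz hxz p hp => ?_⟩
  obtain ⟨b, hb, h0, h1, rfl⟩ := hxy
  obtain ⟨s, hs, rfl⟩ := hp
  set l := dist x y with hl
  have hl0 : 0 ≤ l := dist_nonneg
  have hN0 : (0 : ℝ) ≤ N := by positivity
  obtain ⟨f, hf, hfp⟩ := hX.exists_projection isClosed_Icc ordConnected_Icc ⟨s, hs⟩ hb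
  have hfc := continuous_of_abs_sub_le_dist hf
  have hfx : f x = 0 := by
    rw [← h0]; exact (hfp _ _).1 (projectsTo_self ⟨le_rfl, hl0⟩)
  have hfy : f y = l := by
    rw [← h1]; exact (hfp _ _).1 (projectsTo_self ⟨hl0, le_rfl⟩)
  have near : ∀ {a : X} {S : Set X} {t : ℝ}, IsGeodesicSegment S a z → t ∈ uIcc (f a) (f z) →
      2 * (N : ℝ) ≤ |t - f a| → 2 * (N : ℝ) ≤ |t - f z| → |s - t| ≤ 2 * N →
      ∃ q ∈ S, dist (b s) q ≤ 4 * N := by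
    intro a S t hS ht h1 h2 h3
    obtain ⟨q, hq, rfl⟩ := hS.exists_apply_eq hfc ht
    have hqp := (hfp q _).2 rfl
    have := hX.dist_lt_of_no_grid hN hb (hS.dist_add_dist hq) hqp
      ((hfp a _).2 rfl) ((hfp z _).2 rfl) h1 h2
    refine ⟨q, hq, ?_⟩
    rw [← hb s hs _ hqp.1] at h3
    linarith [dist_triangle_right (b s) q (b (f q))]
  rcases le_total s (f z) with hz | hz
  · rcases le_total s (4 * N) with hs4 | hs4
    · refine ⟨x, Or.inr hxz.left_mem, ?_⟩
      rw [← h0, dist_comm, hb.dist_of_le ⟨le_rfl, hl0⟩ hs hs.1]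
      linarith
    -- The shift by `2 * N` away from `s` keeps the target far from `f z` even when `f z = s`.
    · obtain ⟨q, hq, hd⟩ := near (t := s - 2 * N) hxz
        (by rw [hfx]; exact mem_uIcc_of_le (by linarith) (by linarith))
        (by rw [hfx]; exact le_abs.2 (Or.inl (by linarith)))
        (le_abs.2 (Or.inr (by linarith)))
        (by rw [abs_of_nonneg] <;> linarith)
      exact ⟨q, Or.inr hq, hd⟩
  · rcases le_total (l - s) (4 * N) with hs4 | hs4
    · refine ⟨y, Or.inl hyz.left_mem, ?_⟩
      rw [← h1, hb.dist_of_le hs ⟨hl0, le_rfl⟩ hs.2]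
      linarith
    · obtain ⟨q, hq, hd⟩ := near (t := s + 2 * N) hyz
        (by rw [hfy]; exact mem_uIcc_of_ge (by linarith) (by linarith))
        (by rw [hfy]; exact le_abs.2 (Or.inr (by linarith)))
        (le_abs.2 (Or.inl (by linarith)))
        (by rw [abs_of_nonpos] <;> linarith)
      exact ⟨q, Or.inl hq, hd⟩

/-! ### Grids in hyperbolic spaces -/

lemma Curtain.nonempty_I (h : Curtain X) : h.I.Nonempty :=
  ⟨h.r, interior_subset (h.pole_subset ⟨by linarith, by linarith⟩)⟩

/-- Join two points by going down to `b`, along it, and up again; the projection changes only on the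
middle piece. -/
lemma IsCAT0.isPreconnected_preimage_projection (hX : IsCAT0 X) {b : ℝ → X} {I J : Set ℝ}
    (hI : I.OrdConnected) (hJ : J.OrdConnected) (hb : IsGeodesicOn b I) {f : X → ℝ}
    (hf : ∀ x t, ProjectsTo b I x t ↔ f x = t) : IsPreconnected (f ⁻¹' J) := by
  refine isPreconnected_of_forall_pair fun x hx y hy => ?_
  have hxp := (hf x _).2 rfl
  have hyp := (hf y _).2 rfl
  obtain ⟨S, hS⟩ := hX.exists_segment x (b (f x))
  obtain ⟨T, hT⟩ := hX.exists_segment y (b (f y))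
  have hU : IsPreconnected (b '' uIcc (f x) (f y)) :=
    isPreconnected_uIcc.image _ (hb.mono (hI.uIcc_subset hxp.1 hyp.1)).continuousOn
  refine ⟨S ∪ b '' uIcc (f x) (f y) ∪ T, ?_, Or.inl (Or.inl hS.left_mem), Or.inr hT.left_mem, ?_⟩
  · rintro w ((hw | ⟨t, ht, rfl⟩) | hw)
    · rw [mem_preimage, (hf _ _).1 (hxp.of_dist_add (hS.dist_add_dist hw))]
      exact hx
    · rw [mem_preimage, (hf _ _).1 (projectsTo_self (hI.uIcc_subset hxp.1 hyp.1 ht))]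
      exact hJ.uIcc_subset hx hy ht
    · rw [mem_preimage, (hf _ _).1 (hyp.of_dist_add (hT.dist_add_dist hw))]
      exact hy
  · refine IsPreconnected.union (b (f y)) (Or.inr ⟨_, right_mem_uIcc, rfl⟩) hT.right_mem ?_
      hT.isPreconnected
    exact IsPreconnected.union (b (f x)) hS.right_mem ⟨_, left_mem_uIcc, rfl⟩ hS.isPreconnected hU

/-- A curtain separating `A` from `B` is cut out by a `1`-Lipschitz function that is small on `A`
and large on `B`. -/
lemma IsCAT0.exists_function_of_separates (hX : IsCAT0 X) {h : Curtain X} {A B : Set X}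
    (hs : h.Separates A B) : ∃ g : X → ℝ, (∀ x y, |g x - g y| ≤ dist x y) ∧
      (∀ x, |g x| ≤ 1 / 2 → x ∈ h.carrier) ∧ (∀ x ∈ h.carrier, |g x| ≤ 1 / 2) ∧
      IsPreconnected {x | g x ≤ 1 / 2} ∧ (∀ x ∈ A, g x < -(1 / 2)) ∧ ∀ x ∈ B, 1 / 2 < g x := by
  obtain ⟨f, hf, hfp⟩ := hX.exists_projection h.isClosed_I h.ordConnected_I h.nonempty_I
    h.isGeodesicOn
  have hneg : ∀ x ∈ h.neg, f x - h.r < -(1 / 2) := by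
    rintro x ⟨t, ht, hxt⟩
    rw [(hfp _ _).1 hxt]; linarith
  have hpos : ∀ x ∈ h.pos, 1 / 2 < f x - h.r := by
    rintro x ⟨t, ht, hxt⟩
    rw [(hfp _ _).1 hxt]; linarith
  have hcar : ∀ x, x ∈ h.carrier ↔ |f x - h.r| ≤ 1 / 2 := by
    intro x
    rw [abs_le]
    constructor
    · rintro ⟨t, ht, hxt⟩
      rw [(hfp _ _).1 hxt]
      constructor <;> linarith [ht.1, ht.2]
    · rintro ⟨h1, h2⟩
      exact ⟨f x, ⟨by linarith, by linarith⟩, (hfp _ _).2 rfl⟩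
  rcases hs with ⟨hA, hB⟩ | ⟨hA, hB⟩
  · refine ⟨fun x => f x - h.r, fun x y => by simpa using hf x y, fun x => (hcar x).2,
      fun x => (hcar x).1, ?_, fun x hx => hneg x (hA hx), fun x hx => hpos x (hB hx)⟩
    convert hX.isPreconnected_preimage_projection h.ordConnected_I
      (ordConnected_Iic (a := h.r + 1 / 2)) h.isGeodesicOn hfp using 1
    ext x
    simp only [mem_ofPred_eq, mem_preimage, mem_Iic]
    constructor <;> intro <;> linarith
  · refine ⟨fun x => h.r - f x, fun x y => ?_, fun x hx => (hcar x).2 (by rwa [abs_sub_comm]),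
      fun x hx => by rw [abs_sub_comm]; exact (hcar x).1 hx, ?_, fun x hx => ?_, fun x hx => ?_⟩
    · rw [abs_sub_comm]; simpa using hf x y
    · convert hX.isPreconnected_preimage_projection h.ordConnected_I
        (ordConnected_Ici (a := h.r - 1 / 2)) h.isGeodesicOn hfp using 1
      ext x
      simp only [mem_ofPred_eq, mem_preimage, mem_Ici]
      constructor <;> intro <;> linarith
    · linarith [hpos x (hA hx)]
    · linarith [hneg x (hB hx)]

lemma IsCAT0.isChain_sub_two_le_dist (hX : IsCAT0 X) {n : ℕ} {h : Fin (n + 2) → Curtain X}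
    (hch : IsChain h) {x y : X} (hx : x ∈ (h 0).carrier) (hy : y ∈ (h (Fin.last _)).carrier) :
    (n : ℝ) ≤ dist x y := by
  have ex : ∀ i (hi : i < n), ∃ g : X → ℝ, (∀ x y, |g x - g y| ≤ dist x y) ∧
      (∀ x, |g x| ≤ 1 / 2 → x ∈ (h ⟨i + 1, by omega⟩).carrier) ∧
      (∀ x ∈ (h ⟨i + 1, by omega⟩).carrier, |g x| ≤ 1 / 2) ∧
      IsPreconnected {x | g x ≤ 1 / 2} ∧ (∀ x ∈ (h ⟨i, by omega⟩).carrier, g x < -(1 / 2)) ∧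
      ∀ x ∈ (h ⟨i + 2, by omega⟩).carrier, 1 / 2 < g x := fun i hi =>
    hX.exists_function_of_separates (hch.2 ⟨i, by omega⟩ ⟨i + 1, by omega⟩ ⟨i + 2, by omega⟩ rfl rfl)
  choose g hg hmem hcar hpre hlo hhi using ex
  have hx' : ∀ i (hi : i < n), g i hi x < -(1 / 2) := by
    intro i
    induction i with
    | zero => exact fun hi => hlo 0 hi x hx
    | succ i ih =>
      intro hi
      have ih := ih (by omega)
      by_contra! hge
      -- The connected set where `g i ≤ 1 / 2` contains `x` and this pole point, so it would meet
      -- the next curtain, which lies where `1 / 2 < g i`.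
      have hpole : ∃ z, |g i (by omega) z| ≤ 1 / 2 := by
        refine ⟨(h ⟨i + 1, by omega⟩).b (h ⟨i + 1, by omega⟩).r, hcar i (by omega) _ ?_⟩
        refine ⟨_, ⟨by linarith, by linarith⟩, projectsTo_self ?_⟩
        exact interior_subset ((h ⟨i + 1, by omega⟩).pole_subset ⟨by linarith, by linarith⟩)
      obtain ⟨z, hz⟩ := hpole
      have hzlo := hlo (i + 1) hi z (hmem i (by omega) z hz)
      obtain ⟨w, hw, hwe⟩ := (hpre i (by omega)).intermediate_value
        (show z ∈ {x | g i (by omega) x ≤ 1 / 2} from (abs_le.1 hz).2)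
        (show x ∈ {x | g i (by omega) x ≤ 1 / 2} by simp only [mem_ofPred_eq]; linarith)
        (continuous_of_abs_sub_le_dist (hg (i + 1) hi)).continuousOn ⟨hzlo.le, hge⟩
      have := hhi i (by omega) w (hmem (i + 1) hi w (by rw [hwe, abs_neg]; norm_num))
      exact absurd hw (not_le.2 this)
  -- Each curtain has thickness 1 and must be crossed in turn.
  have key : ∀ i (hi : i < n) (z : X), 1 / 2 < g i hi z → (i : ℝ) + 1 ≤ dist x z := by
    intro i
    induction i with
    | zero =>
      intro hi z hz
      have := (abs_le.1 (hg 0 hi x z)).1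
      have := hx' 0 hi
      push_cast
      linarith
    | succ i ih =>
      intro hi z hz
      have hxi := hx' (i + 1) hi
      obtain ⟨S, hS⟩ := hX.exists_segment x z
      obtain ⟨w, hw, hwe⟩ := hS.exists_apply_eq
        (continuous_of_abs_sub_le_dist (hg (i + 1) hi)) (r := -(1 / 2))
        (mem_uIcc_of_le hxi.le (by linarith))
      have h1 := ih (by omega) w
        (hhi i (by omega) w (hmem (i + 1) hi w (by rw [hwe, abs_neg]; norm_num)))
      have h2 := (abs_le.1 (hg (i + 1) hi w z)).1
      have h3 := hS.dist_add_dist hw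
      push_cast
      linarith
  rcases n with _ | n
  · simp
  · have := key n (by omega) y (hhi n (by omega) y hy)
    push_cast
    linarith

/-- Geodesics between points of a curtain stay close to it in a hyperbolic space. -/
lemma IsCAT0.exists_mem_carrier_dist_le (hX : IsCAT0 X) {δ : ℝ}
    (hδ : ∀ (x y z : X) (Sxy Syz Sxz : Set X), IsGeodesicSegment Sxy x y →
      IsGeodesicSegment Syz y z → IsGeodesicSegment Sxz x z →
      ∀ p ∈ Sxy, ∃ q ∈ Syz ∪ Sxz, dist p q ≤ δ) (h : Curtain X) {x y p : X}
    (hx : x ∈ h.carrier) (hy : y ∈ h.carrier) {S : Set X} (hS : IsGeodesicSegment S x y)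
    (hp : p ∈ S) : ∃ q ∈ h.carrier, dist p q ≤ 2 * δ := by
  obtain ⟨s, hs, hxs⟩ := hx
  obtain ⟨t, ht, hyt⟩ := hy
  wlog hst : s ≤ t generalizing x y s t
  · exact this hS.symm t ht hyt s hs hxs (le_of_not_ge hst)
  obtain ⟨A, hA⟩ := hX.exists_segment x (h.b s)
  obtain ⟨B, hB⟩ := hX.exists_segment y (h.b t)
  obtain ⟨D, hD⟩ := hX.exists_segment y (h.b s)
  have hsub : Icc s t ⊆ h.I := h.ordConnected_I.out hxs.1 hyt.1
  have hC := isGeodesicSegment_image hst (h.isGeodesicOn.mono hsub)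
  have hAc : ∀ q ∈ A, q ∈ h.carrier := fun q hq =>
    ⟨s, hs, hxs.of_dist_add (hA.dist_add_dist hq)⟩
  have hBc : ∀ q ∈ B, q ∈ h.carrier := fun q hq =>
    ⟨t, ht, hyt.of_dist_add (hB.dist_add_dist hq)⟩
  have hCc : ∀ q ∈ h.b '' Icc s t, q ∈ h.carrier := by
    rintro _ ⟨r, hr, rfl⟩
    exact ⟨r, ⟨hs.1.trans hr.1, hr.2.trans ht.2⟩, projectsTo_self (hsub hr)⟩
  obtain ⟨q, hq, hpq⟩ := hδ x y (h.b s) S D A hS hD hA p hp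
  have hδ0 : 0 ≤ δ := dist_nonneg.trans hpq
  rcases hq with hq | hq
  · obtain ⟨w, hw, hqw⟩ := hδ y (h.b s) (h.b t) D _ B hD hC hB q hq
    exact ⟨w, hw.elim (hCc w) (hBc w), by linarith [dist_triangle p q w]⟩
  · exact ⟨q, hAc q hq, by linarith⟩

theorem IsCAT0.exists_thin_of_isGromovHyperbolic (hX : IsCAT0 X) (hG : IsGromovHyperbolic X) :
    ∃ E : ℝ, 0 < E ∧ AllGridsThin X E := by
  obtain ⟨δ, hδ0, hδ⟩ := hG
  -- More than `6 * δ + 5` curtains put the end curtains more than `6 * δ + 3` apart, so no point is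
  -- within `3 * δ + 1` of both.
  refine ⟨6 * δ + 5, by positivity, fun n m H K ⟨hH, hK, hHK⟩ => ?_⟩
  by_contra! hlt
  obtain ⟨hn, hm⟩ := lt_min_iff.1 hlt
  obtain ⟨n, rfl⟩ : ∃ k, n = k + 2 := Nat.exists_eq_add_of_le' (by
    have : (2 : ℝ) < n := by linarith
    exact_mod_cast this.le)
  obtain ⟨m, rfl⟩ : ∃ k, m = k + 2 := Nat.exists_eq_add_of_le' (by
    have : (2 : ℝ) < m := by linarith
    exact_mod_cast this.le)
  push_cast at hn hm
  obtain ⟨a, haH, haK⟩ := hHK 0 0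
  obtain ⟨b, hbH, hbK⟩ := hHK 0 (Fin.last _)
  obtain ⟨c, hcH, hcK⟩ := hHK (Fin.last _) (Fin.last _)
  obtain ⟨d, hdH, hdK⟩ := hHK (Fin.last _) 0
  obtain ⟨Sac, hac⟩ := hX.exists_segment a c
  obtain ⟨Sab, hab⟩ := hX.exists_segment a b
  obtain ⟨Scb, hcb⟩ := hX.exists_segment c b
  obtain ⟨Sad, had⟩ := hX.exists_segment a d
  obtain ⟨Scd, hcd⟩ := hX.exists_segment c d
  have farH : ∀ p q r, q ∈ (H 0).carrier → r ∈ (H (Fin.last _)).carrier → dist p q < 3 * δ + 1 →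
      3 * δ + 1 ≤ dist p r := fun p q r hq hr hpq => by
    have := hX.isChain_sub_two_le_dist hH hq hr
    linarith [dist_triangle_left q r p]
  have farK : ∀ p q r, q ∈ (K 0).carrier → r ∈ (K (Fin.last _)).carrier → dist p q < 3 * δ + 1 →
      3 * δ + 1 ≤ dist p r := fun p q r hq hr hpq => by
    have := hX.isChain_sub_two_le_dist hK hq hr
    linarith [dist_triangle_left q r p]
  have cover : ∀ p ∈ Sac, (∃ q ∈ (H 0).carrier, dist p q ≤ 3 * δ) ∨
      ∃ q ∈ (H (Fin.last _)).carrier, dist p q ≤ 3 * δ := by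
    intro p hp
    have h1 : (∃ q ∈ (H 0).carrier, dist p q ≤ 3 * δ) ∨
        ∃ q ∈ (K (Fin.last _)).carrier, dist p q ≤ 3 * δ := by
      obtain ⟨q, hq | hq, hpq⟩ := hδ a c b Sac Scb Sab hac hcb hab p hp
      · obtain ⟨w, hw, hqw⟩ := hX.exists_mem_carrier_dist_le hδ _ hcK hbK hcb hq
        exact Or.inr ⟨w, hw, by linarith [dist_triangle p q w]⟩
      · obtain ⟨w, hw, hqw⟩ := hX.exists_mem_carrier_dist_le hδ _ haH hbH hab hq
        exact Or.inl ⟨w, hw, by linarith [dist_triangle p q w]⟩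
    have h2 : (∃ q ∈ (H (Fin.last _)).carrier, dist p q ≤ 3 * δ) ∨
        ∃ q ∈ (K 0).carrier, dist p q ≤ 3 * δ := by
      obtain ⟨q, hq | hq, hpq⟩ := hδ a c d Sac Scd Sad hac hcd had p hp
      · obtain ⟨w, hw, hqw⟩ := hX.exists_mem_carrier_dist_le hδ _ hcH hdH hcd hq
        exact Or.inl ⟨w, hw, by linarith [dist_triangle p q w]⟩
      · obtain ⟨w, hw, hqw⟩ := hX.exists_mem_carrier_dist_le hδ _ haK hdK had hq
        exact Or.inr ⟨w, hw, by linarith [dist_triangle p q w]⟩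
    rcases h1 with h1 | ⟨q, hq, hpq⟩
    · exact Or.inl h1
    rcases h2 with h2 | ⟨r, hr, hpr⟩
    · exact Or.inr h2
    · linarith [farK p r q hr hq (by linarith)]
  obtain ⟨p, hp, h1, h2⟩ := isPreconnected_closed_iff.1 hac.isPreconnected
    {p | Metric.infDist p (H 0).carrier ≤ 3 * δ}
    {p | Metric.infDist p (H (Fin.last _)).carrier ≤ 3 * δ}
    (isClosed_le (Metric.continuous_infDist_pt _) continuous_const)
    (isClosed_le (Metric.continuous_infDist_pt _) continuous_const)
    (fun p hp => (cover p hp).imp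
      (fun ⟨q, hq, h⟩ => (Metric.infDist_le_dist_of_mem hq).trans h)
      (fun ⟨q, hq, h⟩ => (Metric.infDist_le_dist_of_mem hq).trans h))
    ⟨a, hac.left_mem, by simp only [mem_ofPred_eq, Metric.infDist_zero_of_mem haH]; positivity⟩
    ⟨c, hac.right_mem, by simp only [mem_ofPred_eq, Metric.infDist_zero_of_mem hcH]; positivity⟩
  -- The distance to a curtain need not be attained, hence the slack of 1.
  obtain ⟨q, hq, hpq⟩ := (Metric.infDist_lt_iff ⟨a, haH⟩).1
    (lt_of_le_of_lt h1 (by linarith : 3 * δ < 3 * δ + 1))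
  obtain ⟨r, hr, hpr⟩ := (Metric.infDist_lt_iff ⟨c, hcH⟩).1
    (lt_of_le_of_lt h2 (by linarith : 3 * δ < 3 * δ + 1))
  linarith [farH p q r hq hr hpq]

end CurtainGrid

theorem theoremE {X : Type*} [MetricSpace X] (hX : CurtainGrid.IsCAT0 X) :
    CurtainGrid.IsGromovHyperbolic X ↔
      ∃ E : ℝ, 0 < E ∧ CurtainGrid.AllGridsThin X E :=
  ⟨hX.exists_thin_of_isGromovHyperbolic, fun ⟨_, _, hE⟩ => hX.isGromovHyperbolic_of_thin hE⟩
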